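/- Let $p$ be a prime number, let $\mathbb{C}_p$ be the completion of an algebraic closure of $\mathbb{Q}_p$, and let $\mathbb{C}_p^\circ$ be its ring of integers (the closed unit ball). Let $\Psi_p(T)=\sum_{n\ge 1}a_nT^n$ be the unique power series in $T+T^2\mathbb{Z}[[T]]$ satisfying $$\sum_{j=0}^{\infty}p^{-j}\,\Psi_p(p^jT)^{p^j}=T ,$$ where the sum is taken $T$-adically in $\mathbb{Q}[[T]]$. Then $\Psi_p(x)=\sum_n a_nx^n$ converges for every $x\in\mathbb{C}_p$, the resulting function $\Psi_p:\mathbb{C}_p\to\mathbb{C}_p$ maps $\mathbb{Q}_p$ into $\mathbb{Z}_p$, and its restriction $\mathbb{Q}_p\to\mathbb{Z}_p$ is uniformly continuous. More precisely, for every integer $j\ge 0$ and every $x\in\mathbb{Q}_p$, $$\Psi_p(x+p^j\mathbb{C}_p^\circ)\subseteq\Psi_p(x)+p^j\mathbb{C}_p^\circ .$$ -/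

import Mathlib

open PowerSeries

/-- The `j`-th term `p^(-j) * Ψ(p^j T)^(p^j)` of the functional relation that defines `Ψ_p`,
as a formal power series with rational coefficients. -/
noncomputable def psiTerm (p : ℕ) (φ : ℤ⟦X⟧) (j : ℕ) : ℚ⟦X⟧ :=
  C (((p : ℚ) ^ j)⁻¹) * (rescale ((p : ℚ) ^ j) (φ.map (Int.castRingHom ℚ))) ^ p ^ j

/-- `φ` belongs to `T + T² ℤ⟦T⟧` and satisfies `∑_{j ≥ 0} p^(-j) φ(p^j T)^(p^j) = T`. The sum of
formal power series is taken `T`-adically: each coefficient of the partial sums is eventually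
equal to the corresponding coefficient of `T`. -/
def IsPsiSeries (p : ℕ) (φ : ℤ⟦X⟧) : Prop :=
  coeff 0 φ = 0 ∧ coeff 1 φ = 1 ∧
    ∀ n : ℕ, ∀ᶠ N in Filter.atTop,
      coeff n (∑ j ∈ Finset.range N, psiTerm p φ j) = coeff n (X : ℚ⟦X⟧)

theorem coeff_psiTerm (p : ℕ) (φ : ℤ⟦X⟧) (j n : ℕ) :
    coeff n (psiTerm p φ j) =
      ((p : ℚ) ^ j)⁻¹ * (((p : ℚ) ^ j) ^ n * ((coeff n (φ ^ p ^ j) : ℤ) : ℚ)) := by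
  rw [psiTerm, coeff_C_mul, ← map_pow, coeff_rescale, ← map_pow, coeff_map]
  rfl

theorem coeff_psiTerm_zero (p : ℕ) (φ : ℤ⟦X⟧) (n : ℕ) :
    coeff n (psiTerm p φ 0) = ((coeff n φ : ℤ) : ℚ) := by
  simp [coeff_psiTerm]

/-- Powers `φ ^ (p ^ j)` with `n ≤ j` do not contribute to the coefficient of `T ^ n`. -/
theorem coeff_psiTerm_of_le {p : ℕ} (hp : 2 ≤ p) {φ : ℤ⟦X⟧} (h0 : coeff 0 φ = 0)
    {j n : ℕ} (h : n ≤ j) : coeff n (psiTerm p φ j) = 0 := by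
  have h1 : (X : ℤ⟦X⟧) ∣ φ := X_dvd_iff.2 (by simpa using h0)
  have h2 : coeff n (φ ^ p ^ j) = 0 :=
    X_pow_dvd_iff.1 (pow_dvd_pow_of_dvd h1 (p ^ j)) n (h.trans_lt (Nat.lt_pow_self hp))
  simp [coeff_psiTerm, h2]

/-- In powers with exponent at least `2`, the coefficient of `T ^ n` depends only on the
coefficients of smaller index. -/
theorem coeff_pow_congr {φ χ : ℤ⟦X⟧} (hφ : coeff 0 φ = 0) (hχ : coeff 0 χ = 0) {k n : ℕ}
    (hk : 2 ≤ k) (h : ∀ m < n, coeff m φ = coeff m χ) :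
    coeff n (φ ^ k) = coeff n (χ ^ k) := by
  have h1 : (X : ℤ⟦X⟧) ∣ φ := X_dvd_iff.2 (by simpa using hφ)
  have h2 : (X : ℤ⟦X⟧) ∣ χ := X_dvd_iff.2 (by simpa using hχ)
  have h3 : (X : ℤ⟦X⟧) ^ n ∣ φ - χ :=
    X_pow_dvd_iff.2 fun m hm => by rw [map_sub, h m hm, sub_self]
  have h4 : (X : ℤ⟦X⟧) ∣ ∑ i ∈ Finset.range k, φ ^ i * χ ^ (k - 1 - i) := by
    refine Finset.dvd_sum fun i hi => ?_
    rcases Nat.eq_zero_or_pos i with rfl | hi0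
    · exact Dvd.dvd.mul_left (h2.trans (dvd_pow_self _ (by omega))) _
    · exact Dvd.dvd.mul_right (h1.trans (dvd_pow_self _ (by omega))) _
  have h5 : (X : ℤ⟦X⟧) ^ (n + 1) ∣ φ ^ k - χ ^ k := by
    rw [← Commute.geom_sum₂_mul (Commute.all φ χ) k, pow_succ']
    exact mul_dvd_mul h4 h3
  have h6 := X_pow_dvd_iff.1 h5 n (Nat.lt_succ_self n)
  rwa [map_sub, sub_eq_zero] at h6

theorem coeff_psiTerm_congr {p : ℕ} (hp : 2 ≤ p) {φ χ : ℤ⟦X⟧} (hφ : coeff 0 φ = 0)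
    (hχ : coeff 0 χ = 0) {j n : ℕ} (hj : j ≠ 0) (h : ∀ m < n, coeff m φ = coeff m χ) :
    coeff n (psiTerm p φ j) = coeff n (psiTerm p χ j) := by
  rw [coeff_psiTerm, coeff_psiTerm,
    coeff_pow_congr hφ hχ (hp.trans (Nat.le_self_pow hj p)) h]

/-- The coefficients of `Ψ_p`, solving the functional relation recursively. -/
noncomputable def psiCoeff (p : ℕ) : ℕ → ℤ
  | n => (if n = 1 then 1 else 0) - ∑ j ∈ Finset.Ico 1 n, ((p : ℤ) ^ j) ^ (n - 1) *
      coeff n ((PowerSeries.mk fun m => if _h : m < n then psiCoeff p m else 0) ^ p ^ j)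

theorem isPsiSeries_mk_psiCoeff {p : ℕ} (hp : 2 ≤ p) :
    IsPsiSeries p (PowerSeries.mk (psiCoeff p)) := by
  have h0 : psiCoeff p 0 = 0 := by rw [psiCoeff]; simp
  have h1 : psiCoeff p 1 = 1 := by rw [psiCoeff]; simp
  have hp0 : (p : ℚ) ≠ 0 := by
    have : p ≠ 0 := by omega
    exact_mod_cast this
  refine ⟨by rw [coeff_mk, h0], by rw [coeff_mk, h1], fun n => ?_⟩
  filter_upwards [Filter.eventually_ge_atTop (n + 1)] with N hN
  rw [map_sum, ← Finset.sum_subset (Finset.range_mono hN) (fun j _ hj => coeff_psiTerm_of_le hp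
    (by rw [coeff_mk, h0]) (by simpa using Nat.le_of_lt (by simpa using hj)))]
  rw [Finset.sum_range_succ, Finset.range_eq_Ico]
  rcases Nat.eq_zero_or_pos n with rfl | hn
  · simp [coeff_psiTerm_zero, h0]
  rw [coeff_psiTerm_of_le hp (by rw [coeff_mk, h0]) le_rfl, add_zero,
    Finset.sum_eq_sum_Ico_succ_bot hn, coeff_psiTerm_zero, coeff_mk, zero_add, psiCoeff]
  have key : ∀ j ∈ Finset.Ico 1 n, coeff n (psiTerm p (PowerSeries.mk (psiCoeff p)) j) =
      (((p : ℤ) ^ j) ^ (n - 1) * coeff n ((PowerSeries.mk fun m =>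
        if _h : m < n then psiCoeff p m else 0) ^ p ^ j) : ℤ) := by
    intro j hj
    rw [Finset.mem_Ico] at hj
    rw [coeff_psiTerm_congr hp (χ := PowerSeries.mk fun m =>
      if _h : m < n then psiCoeff p m else 0) (by rw [coeff_mk, h0])
      (by rw [coeff_mk, dif_pos hn, h0]) (by omega)
      (fun m hm => by rw [coeff_mk, coeff_mk, dif_pos hm]), coeff_psiTerm]
    obtain ⟨k, rfl⟩ : ∃ k, n = k + 1 := ⟨n - 1, by omega⟩
    have hpj : (p : ℚ) ^ j ≠ 0 := pow_ne_zero _ hp0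
    push_cast
    rw [pow_succ ((p : ℚ) ^ j) k]
    field_simp
  rw [Finset.sum_congr rfl key, ← Int.cast_sum, ← Int.cast_add, sub_add_cancel, coeff_X]
  split_ifs <;> simp

/-- The functional relation has exactly one solution in `T + T² ℤ⟦T⟧`. -/
theorem existsUnique_isPsiSeries (p : ℕ) [Fact p.Prime] : ∃! φ : ℤ⟦X⟧, IsPsiSeries p φ := by
  have hp : 2 ≤ p := (Fact.out : p.Prime).two_le
  refine ⟨_, isPsiSeries_mk_psiCoeff hp, fun φ hφ => ?_⟩
  obtain ⟨a0, -, ha⟩ := hφ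
  obtain ⟨b0, -, hb⟩ := isPsiSeries_mk_psiCoeff hp
  ext n
  induction n using Nat.strong_induction_on with
  | _ n ih =>
    obtain ⟨N, h1, h2, h3⟩ := ((ha n).and ((hb n).and (Filter.eventually_ge_atTop 1))).exists
    rw [← h2, map_sum, map_sum, Finset.range_eq_Ico, Finset.sum_eq_sum_Ico_succ_bot h3,
      Finset.sum_eq_sum_Ico_succ_bot h3, coeff_psiTerm_zero, coeff_psiTerm_zero,
      Finset.sum_congr rfl (fun j hj => coeff_psiTerm_congr hp a0 b0
        (by have := (Finset.mem_Ico.1 hj).1; omega) ih), add_left_inj] at h1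
    exact_mod_cast h1

/-- The power series `Ψ_p(T) ∈ T + T² ℤ⟦T⟧`: the unique solution there of
`∑_{j ≥ 0} p^(-j) Ψ(p^j T)^(p^j) = T`. -/
noncomputable def psiSeries (p : ℕ) [Fact p.Prime] : ℤ⟦X⟧ :=
  (existsUnique_isPsiSeries p).choose

theorem isPsiSeries_psiSeries (p : ℕ) [Fact p.Prime] : IsPsiSeries p (psiSeries p) :=
  (existsUnique_isPsiSeries p).choose_spec.1

/-- The function `Ψ_p : ℂ_p → ℂ_p`, the sum of the power series `Ψ_p(T)`. -/
noncomputable def Psi (p : ℕ) [Fact p.Prime] (x : ℂ_[p]) : ℂ_[p] :=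
  ∑' n : ℕ, ((coeff n (psiSeries p) : ℤ) : ℂ_[p]) * x ^ n

/-!
Write `X_j = Ψ_p(p^j x)`, so that the functional relation reads `∑_{j ≥ 0} p^(-j) X_j^(p^j) = x`.
Everything follows from solving it for its term `j = 0` and using that the other terms involve
`Ψ_p` only at the `p`-adically smaller points `p^j x`.

*Convergence.* The coefficients of `Ψ_p` are integers, so its Gauss norm is at most `r` for every
radius `r ≤ 1`. Suppose it is finite for the radius `p^m`. On the disc of radius `p^(m+1)` the terms
with `j ≥ 1` evaluate `Ψ_p` on the disc of radius `p^m`, and all but finitely many of them are small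
there, because `p^j` is negligible against the `p^j`-th power of a number below `1`. Hence the
Gauss norm is finite for the radius `p^(m+1)` too (`exists_gaussLE_psiOver`). The same estimate of
the far terms turns the formal relation into one between values (`tendsto_sum_seriesEval_psiOver`).

*Integrality.* Dividing the relation at `p x` by `p` gives `x = ∑_{j ≥ 1} p^(-j) X_j^(p^(j-1))`.
Subtracting it from the relation at `x` yields
`Ψ_p(x) = ∑_{j ≥ 1} p^(-j) (X_j^(p^(j-1)) - X_j^(p^j))`. If `x` is in `ℚ_p` and all `X_j` with
`j ≥ 1` are in `ℤ_p`, the congruence `z^p ≡ z` modulo `p` on `ℤ_p`, raised to the power `p^(j-1)`,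
shows that every term of the sum is in `ℤ_p`. Induction on the size of `x` proves
`norm_seriesEval_psiOver_le_one`.

*Continuity.* Let `x` be in `ℚ_p` and `|h| ≤ 1`. By induction `Ψ_p(p^j (x + h))` and `X_j` have norm at
most `1` and differ by at most `|p^j h|` for `j ≥ 1`, so their `p^j`-th powers do as well, and the
factor `p^(-j)` leaves `|h|`. Comparing the relations at `x + h` and `x` gives
`|Ψ_p(x + h) - Ψ_p(x)| ≤ |h|` (`norm_seriesEval_psiOver_sub_le`).
-/

/-! ### Everywhere convergent power series over an ultrametric field -/

section Entire

theorem norm_pow_sub_pow_le_of_le_one {K : Type*} [NormedField K] [IsUltrametricDist K] {u v : K}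
    (hu : ‖u‖ ≤ 1) (hv : ‖v‖ ≤ 1) (n : ℕ) : ‖u ^ n - v ^ n‖ ≤ ‖u - v‖ := by
  rw [← Commute.geom_sum₂_mul (Commute.all u v) n, norm_mul]
  refine mul_le_of_le_one_left (norm_nonneg _) ?_
  refine IsUltrametricDist.norm_sum_le_of_forall_le_of_nonneg zero_le_one fun i _ => ?_
  rw [norm_mul, norm_pow, norm_pow]
  exact mul_le_one₀ (pow_le_one₀ (norm_nonneg _) hu) (by positivity)
    (pow_le_one₀ (norm_nonneg _) hv)

variable {K : Type*} [NormedField K]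

/-- The Gauss norm of `f` for the radius `r` is at most `M`: every term of `f` is bounded by `M`
on the closed disc of radius `r`. -/
def GaussLE (r M : ℝ) (f : K⟦X⟧) : Prop :=
  ∀ n, ‖coeff n f‖ * r ^ n ≤ M

/-- `f` has finite Gauss norm for every radius. Over a complete field such a series converges
everywhere. -/
def IsEntireSeries (f : K⟦X⟧) : Prop :=
  ∀ r, 0 ≤ r → ∃ M, GaussLE r M f

/-- The sum of the power series `f` at `x`; it is `0` where the series does not converge. -/
noncomputable def seriesEval (f : K⟦X⟧) (x : K) : K :=
  ∑' n, coeff n f * x ^ n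

namespace GaussLE

variable {r s A B : ℝ} {f g : K⟦X⟧}

theorem nonneg (h : GaussLE r A f) : 0 ≤ A := by
  have := h 0
  rw [pow_zero, mul_one] at this
  exact (norm_nonneg _).trans this

theorem mono (h : GaussLE r A f) (hs : 0 ≤ s) (hsr : s ≤ r) (hAB : A ≤ B) : GaussLE s B f :=
  fun n => (mul_le_mul_of_nonneg_left (pow_le_pow_left₀ hs hsr n) (norm_nonneg _)).trans
    ((h n).trans hAB)

theorem one : GaussLE r 1 (1 : K⟦X⟧) := by
  intro n
  rcases n with _ | n <;> simp [coeff_one]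

theorem const_mul (h : GaussLE r A f) (c : K) : GaussLE r (‖c‖ * A) (C c * f) := by
  intro n
  rw [coeff_C_mul, norm_mul, mul_assoc]
  exact mul_le_mul_of_nonneg_left (h n) (norm_nonneg _)

theorem rescale {c : K} (h : GaussLE (‖c‖ * r) A f) : GaussLE r A (PowerSeries.rescale c f) := by
  intro n
  have := h n
  rw [coeff_rescale, norm_mul, norm_pow, mul_comm (‖c‖ ^ n), mul_assoc, ← mul_pow]
  exact this

variable [IsUltrametricDist K]

theorem add (hf : GaussLE r A f) (hg : GaussLE r A g) (hr : 0 ≤ r) : GaussLE r A (f + g) := by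
  intro n
  rw [map_add]
  rcases le_max_iff.1 (IsUltrametricDist.norm_add_le_max (coeff n f) (coeff n g)) with h | h
  · exact (mul_le_mul_of_nonneg_right h (pow_nonneg hr n)).trans (hf n)
  · exact (mul_le_mul_of_nonneg_right h (pow_nonneg hr n)).trans (hg n)

theorem mul (hf : GaussLE r A f) (hg : GaussLE r B g) (hr : 0 ≤ r) :
    GaussLE r (A * B) (f * g) := by
  intro n
  have hne : (Finset.HasAntidiagonal.antidiagonal n).Nonempty := ⟨(0, n), by simp⟩
  obtain ⟨⟨i, j⟩, hij, hle⟩ := IsUltrametricDist.exists_norm_finsetSum_le_of_nonempty hne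
    (fun ij : ℕ × ℕ => coeff ij.1 f * coeff ij.2 g)
  rw [Finset.HasAntidiagonal.mem_antidiagonal] at hij
  simp only at hij
  rw [coeff_mul]
  refine (mul_le_mul_of_nonneg_right hle (pow_nonneg hr n)).trans ?_
  rw [norm_mul, ← hij, pow_add, mul_mul_mul_comm]
  exact mul_le_mul (hf i) (hg j) (mul_nonneg (norm_nonneg _) (pow_nonneg hr j)) hf.nonneg

theorem pow (hf : GaussLE r A f) (hr : 0 ≤ r) (k : ℕ) : GaussLE r (A ^ k) (f ^ k) := by
  induction k with
  | zero => simpa using one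
  | succ k ih => simpa only [pow_succ] using ih.mul hf hr

end GaussLE

namespace IsEntireSeries

variable {f g : K⟦X⟧}

/-- A bound on the disc of radius `2 * ‖x‖ + 1` makes the terms at `x` decay geometrically. -/
theorem summable_norm (h : IsEntireSeries f) (x : K) :
    Summable fun n => ‖coeff n f * x ^ n‖ := by
  obtain ⟨M, hM⟩ := h (2 * ‖x‖ + 1) (by positivity)
  refine Summable.of_nonneg_of_le (fun _ => norm_nonneg _) (fun n => ?_)
    ((summable_geometric_of_lt_one (by norm_num) (by norm_num : (2⁻¹ : ℝ) < 1)).mul_left M)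
  have h1 : ‖x‖ ^ n ≤ (2 * ‖x‖ + 1) ^ n * 2⁻¹ ^ n := by
    rw [← mul_pow]
    exact pow_le_pow_left₀ (norm_nonneg _) (by linarith [norm_nonneg x]) n
  rw [norm_mul, norm_pow]
  calc ‖coeff n f‖ * ‖x‖ ^ n ≤ ‖coeff n f‖ * ((2 * ‖x‖ + 1) ^ n * 2⁻¹ ^ n) :=
        mul_le_mul_of_nonneg_left h1 (norm_nonneg _)
    _ = ‖coeff n f‖ * (2 * ‖x‖ + 1) ^ n * 2⁻¹ ^ n := by ring
    _ ≤ M * 2⁻¹ ^ n := mul_le_mul_of_nonneg_right (hM n) (by positivity)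

theorem X : IsEntireSeries (X : K⟦X⟧) := by
  intro r hr
  refine ⟨r, fun n => ?_⟩
  rw [coeff_X]
  split_ifs with hn <;> simp [hn, hr]

theorem const_mul (hf : IsEntireSeries f) (c : K) : IsEntireSeries (C c * f) := fun r hr =>
  let ⟨_, hA⟩ := hf r hr
  ⟨_, hA.const_mul c⟩

theorem rescale (hf : IsEntireSeries f) (c : K) : IsEntireSeries (PowerSeries.rescale c f) :=
  fun r hr =>
    let ⟨_, hA⟩ := hf (‖c‖ * r) (by positivity)
    ⟨_, hA.rescale⟩

variable [IsUltrametricDist K]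

theorem add (hf : IsEntireSeries f) (hg : IsEntireSeries g) : IsEntireSeries (f + g) :=
  fun r hr =>
    let ⟨A, hA⟩ := hf r hr
    let ⟨B, hB⟩ := hg r hr
    ⟨max A B, (hA.mono hr le_rfl (le_max_left A B)).add (hB.mono hr le_rfl (le_max_right A B)) hr⟩

theorem pow (hf : IsEntireSeries f) (k : ℕ) : IsEntireSeries (f ^ k) := fun r hr =>
  let ⟨_, hA⟩ := hf r hr
  ⟨_, hA.pow hr k⟩

theorem sum {ι : Type*} (s : Finset ι) {f : ι → K⟦X⟧} (hf : ∀ i ∈ s, IsEntireSeries (f i)) :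
    IsEntireSeries (∑ i ∈ s, f i) := by
  classical
  refine Finset.sum_induction f IsEntireSeries (fun _ _ => add) ?_ hf
  exact fun r _ => ⟨0, fun n => by simp⟩

end IsEntireSeries

theorem seriesEval_X (x : K) : seriesEval X x = x := by
  rw [seriesEval, tsum_eq_single 1 (fun n hn => by simp [coeff_X, hn])]
  simp

theorem seriesEval_one (x : K) : seriesEval 1 x = 1 := by
  rw [seriesEval, tsum_eq_single 0 (fun n hn => by simp [coeff_one, hn])]
  simp

theorem seriesEval_const_mul (c : K) (f : K⟦X⟧) (x : K) :
    seriesEval (C c * f) x = c * seriesEval f x := by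
  simp_rw [seriesEval, coeff_C_mul, mul_assoc, tsum_mul_left]

theorem seriesEval_rescale (c : K) (f : K⟦X⟧) (x : K) :
    seriesEval (rescale c f) x = seriesEval f (c * x) := by
  simp_rw [seriesEval, coeff_rescale, mul_pow]
  exact tsum_congr fun n => by ring

theorem norm_seriesEval_le [IsUltrametricDist K] {f : K⟦X⟧} {x : K} {r M : ℝ}
    (hx : ‖x‖ ≤ r) (h : GaussLE r M f) : ‖seriesEval f x‖ ≤ M := by
  refine IsUltrametricDist.norm_tsum_le_of_forall_le fun n => ?_
  rw [norm_mul, norm_pow]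
  exact h.mono (norm_nonneg _) hx le_rfl n

variable [CompleteSpace K] {f g : K⟦X⟧}

theorem IsEntireSeries.summable (h : IsEntireSeries f) (x : K) :
    Summable fun n => coeff n f * x ^ n :=
  (h.summable_norm x).of_norm

theorem seriesEval_add (hf : IsEntireSeries f) (hg : IsEntireSeries g) (x : K) :
    seriesEval (f + g) x = seriesEval f x + seriesEval g x := by
  simp_rw [seriesEval, map_add, add_mul]
  exact (hf.summable x).tsum_add (hg.summable x)

theorem seriesEval_sub (hf : IsEntireSeries f) (hg : IsEntireSeries g) (x : K) :
    seriesEval (f - g) x = seriesEval f x - seriesEval g x := by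
  simp_rw [seriesEval, map_sub, sub_mul]
  exact (hf.summable x).tsum_sub (hg.summable x)

theorem seriesEval_mul (hf : IsEntireSeries f) (hg : IsEntireSeries g) (x : K) :
    seriesEval (f * g) x = seriesEval f x * seriesEval g x := by
  rw [seriesEval, seriesEval, seriesEval, tsum_mul_tsum_eq_tsum_sum_antidiagonal_of_summable_norm
    (hf.summable_norm x) (hg.summable_norm x)]
  refine tsum_congr fun n => ?_
  rw [coeff_mul, Finset.sum_mul]
  refine Finset.sum_congr rfl fun ij hij => ?_
  rw [← Finset.HasAntidiagonal.mem_antidiagonal.1 hij, pow_add, mul_mul_mul_comm]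

variable [IsUltrametricDist K]

theorem seriesEval_pow (hf : IsEntireSeries f) (x : K) (k : ℕ) :
    seriesEval (f ^ k) x = seriesEval f x ^ k := by
  induction k with
  | zero => simp [seriesEval_one]
  | succ k ih => rw [pow_succ, seriesEval_mul (hf.pow k) hf, ih, pow_succ]

theorem seriesEval_sum_range {f : ℕ → K⟦X⟧} (hf : ∀ i, IsEntireSeries (f i)) (x : K) (N : ℕ) :
    seriesEval (∑ i ∈ Finset.range N, f i) x = ∑ i ∈ Finset.range N, seriesEval (f i) x := by
  induction N with
  | zero => simp [seriesEval]
  | succ N ih =>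
    rw [Finset.sum_range_succ, Finset.sum_range_succ,
      seriesEval_add (IsEntireSeries.sum _ fun i _ => hf i) (hf N), ih]

end Entire

/-! ### The functional relation over a field of characteristic zero -/

section Psi

variable (p : ℕ) [hp : Fact p.Prime]

/-- The series `Ψ_p` with its coefficients read in `K`. -/
noncomputable def psiOver (K : Type*) [Ring K] : K⟦X⟧ :=
  (psiSeries p).map (Int.castRingHom K)

/-- The `j`-th term `p^(-j) * Ψ_p(p^j T)^(p^j)` of the functional relation, over `K`. -/
noncomputable def psiTermOver (K : Type*) [Field K] (j : ℕ) : K⟦X⟧ :=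
  C (((p : K) ^ j)⁻¹) * (rescale ((p : K) ^ j) (psiOver p K)) ^ p ^ j

theorem coeff_psiOver (K : Type*) [Ring K] (n : ℕ) :
    coeff n (psiOver p K) = ((coeff n (psiSeries p) : ℤ) : K) := rfl

theorem psiTermOver_zero (K : Type*) [Field K] : psiTermOver p K 0 = psiOver p K := by
  simp [psiTermOver]

section Coefficients

variable (K : Type*) [Field K] [CharZero K]

theorem coeff_psiTermOver (j n : ℕ) :
    coeff n (psiTermOver p K j) = ((coeff n (psiTerm p (psiSeries p) j) : ℚ) : K) := by
  rw [coeff_psiTerm, psiTermOver, coeff_C_mul, ← map_pow, coeff_rescale, psiOver, ← map_pow,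
    coeff_map]
  push_cast
  rfl

theorem coeff_psiTermOver_of_le {j n : ℕ} (h : n ≤ j) : coeff n (psiTermOver p K j) = 0 := by
  rw [coeff_psiTermOver, coeff_psiTerm_of_le hp.out.two_le
    (isPsiSeries_psiSeries p).1 h, Rat.cast_zero]

/-- The functional relation, coefficient by coefficient: beyond index `n` the terms do not
contribute to the coefficient of `T ^ n`. -/
theorem coeff_sum_psiTermOver {n N : ℕ} (h : n ≤ N) :
    coeff n (∑ j ∈ Finset.range N, psiTermOver p K j) = coeff n (X : K⟦X⟧) := by
  obtain ⟨N', h1, h2⟩ :=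
    (((isPsiSeries_psiSeries p).2.2 n).and (Filter.eventually_ge_atTop N)).exists
  have h3 : coeff n (∑ j ∈ Finset.range N, psiTermOver p K j) =
      coeff n (∑ j ∈ Finset.range N', psiTermOver p K j) := by
    rw [map_sum, map_sum]
    refine Finset.sum_subset (Finset.range_mono h2) fun j _ hj => ?_
    exact coeff_psiTermOver_of_le p K (h.trans (by simpa using hj))
  rw [h3, map_sum]
  simp_rw [coeff_psiTermOver]
  rw [← Rat.cast_sum, ← map_sum, h1, coeff_X, coeff_X]
  split_ifs <;> simp

end Coefficients

/-! ### Convergence of `Ψ_p` -/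

theorem norm_natCast_prime_of_normedAlgebra (K : Type*) [NormedField K] [NormedAlgebra ℚ_[p] K] :
    ‖(p : K)‖ = (p : ℝ)⁻¹ := by
  rw [← map_natCast (algebraMap ℚ_[p] K), norm_algebraMap', Padic.norm_p]

variable (K : Type*) [NormedField K] [IsUltrametricDist K]

/-- On a disc of radius `r ≤ 1` the linear term of `Ψ_p` dominates. -/
theorem gaussLE_psiOver_of_le_one {r : ℝ} (hr : 0 ≤ r) (hr1 : r ≤ 1) :
    GaussLE r r (psiOver p K) := by
  intro n
  rw [coeff_psiOver]
  rcases n with _ | n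
  · rw [(isPsiSeries_psiSeries p).1]
    simpa using hr
  · calc _ ≤ 1 * r ^ (n + 1) := mul_le_mul_of_nonneg_right
          (IsUltrametricDist.norm_intCast_le_one K _) (by positivity)
      _ ≤ r := by
          rw [one_mul]
          exact pow_le_of_le_one hr hr1 (Nat.succ_ne_zero n)

variable [NormedAlgebra ℚ_[p] K]

theorem gaussLE_psiTermOver {r A : ℝ} (hr : 0 ≤ r) (j : ℕ)
    (h : GaussLE (r / (p : ℝ) ^ j) A (psiOver p K)) :
    GaussLE r ((p : ℝ) ^ j * A ^ p ^ j) (psiTermOver p K j) := by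
  have hn : ‖(p : K) ^ j‖ = ((p : ℝ) ^ j)⁻¹ := by
    rw [norm_pow, norm_natCast_prime_of_normedAlgebra, inv_pow]
  have h1 : GaussLE r A (rescale ((p : K) ^ j) (psiOver p K)) :=
    GaussLE.rescale (by rwa [hn, mul_comm, ← div_eq_mul_inv])
  have h2 := (h1.pow hr (p ^ j)).const_mul (((p : K) ^ j)⁻¹)
  rwa [norm_inv, hn, inv_inv] at h2

/-- Far terms of the functional relation are uniformly small on a fixed disc. -/
theorem gaussLE_psiTermOver_of_lt {m j : ℕ} (h : m + 1 < j) :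
    GaussLE ((p : ℝ) ^ m) (((p : ℝ) ^ j)⁻¹) (psiTermOver p K j) := by
  have hp2 := hp.out.two_le
  have hp1 : (1 : ℝ) ≤ p := by exact_mod_cast (by omega : 1 ≤ p)
  have hp0 : (0 : ℝ) < p := by linarith
  have hle : (p : ℝ) ^ m / (p : ℝ) ^ j ≤ ((p : ℝ) ^ 2)⁻¹ := by
    rw [div_le_iff₀ (by positivity), inv_mul_eq_div, le_div_iff₀ (by positivity), ← pow_add]
    exact pow_le_pow_right₀ hp1 h
  have h1 : GaussLE ((p : ℝ) ^ m / (p : ℝ) ^ j) ((p : ℝ) ^ 2)⁻¹ (psiOver p K) :=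
    (gaussLE_psiOver_of_le_one p K (by positivity)
      (hle.trans (inv_le_one_of_one_le₀ (one_le_pow₀ hp1)))).mono (by positivity) le_rfl hle
  refine (gaussLE_psiTermOver p K (by positivity) j h1).mono (by positivity) le_rfl ?_
  rw [inv_pow, ← div_eq_mul_inv, div_le_iff₀ (by positivity), inv_mul_eq_div,
    le_div_iff₀ (by positivity), ← pow_add, ← pow_mul]
  -- The remaining inequality of exponents is `2 * j ≤ 2 * p ^ j`.
  have := (Nat.lt_pow_self (show 1 < p by omega) : j < p ^ j)
  exact pow_le_pow_right₀ hp1 (by omega)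

variable [CharZero K]

/-- The functional relation bounds `Ψ_p` on the disc of radius `p ^ (m + 1)` by its values on the
disc of radius `p ^ m`. -/
theorem exists_gaussLE_psiOver (m : ℕ) : ∃ M, GaussLE ((p : ℝ) ^ m) M (psiOver p K) := by
  have hp2 := hp.out.two_le
  have hp1 : (1 : ℝ) ≤ p := by exact_mod_cast (by omega : 1 ≤ p)
  have hp0 : (0 : ℝ) < p := by linarith
  induction m with
  | zero => exact ⟨1, by simpa using gaussLE_psiOver_of_le_one p K zero_le_one le_rfl⟩
  | succ m ih =>
    obtain ⟨M₀, hM₀⟩ := ih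
    obtain ⟨M, hM1, hM⟩ : ∃ M : ℝ, 1 ≤ M ∧ GaussLE ((p : ℝ) ^ m) M (psiOver p K) :=
      ⟨max 1 M₀, le_max_left _ _, hM₀.mono (by positivity) le_rfl (le_max_right _ _)⟩
    -- For `1 ≤ j ≤ m + 2` the term is at most `p ^ j * M ^ (p ^ j)`, which is largest at `j = m + 2`;
    -- the later terms are at most `1`.
    set B : ℝ := (p : ℝ) ^ (m + 2) * M ^ p ^ (m + 2) with hB
    have hB1 : (p : ℝ) ^ (m + 2) ≤ B := le_mul_of_one_le_right (by positivity) (one_le_pow₀ hM1)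
    have hterm : ∀ j ≠ 0, GaussLE ((p : ℝ) ^ (m + 1)) B (psiTermOver p K j) := by
      intro j hj
      rcases le_or_gt j (m + 2) with hjm | hjm
      · have h1 : GaussLE ((p : ℝ) ^ (m + 1) / (p : ℝ) ^ j) M (psiOver p K) := by
          refine hM.mono (by positivity) ?_ le_rfl
          rw [div_le_iff₀ (by positivity), ← pow_add]
          exact pow_le_pow_right₀ hp1 (by omega)
        refine (gaussLE_psiTermOver p K (by positivity) j h1).mono (by positivity) le_rfl ?_
        exact mul_le_mul (pow_le_pow_right₀ hp1 hjm)
          (pow_le_pow_right₀ hM1 (Nat.pow_le_pow_right (by omega) hjm)) (by positivity)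
          (by positivity)
      · refine (gaussLE_psiTermOver_of_lt p K hjm).mono (by positivity) le_rfl ?_
        exact (inv_le_one_of_one_le₀ (one_le_pow₀ hp1)).trans ((one_le_pow₀ hp1).trans hB1)
    have hX : GaussLE ((p : ℝ) ^ (m + 1)) B (X : K⟦X⟧) := by
      intro n
      rw [coeff_X]
      split_ifs with hn
      · rw [hn, norm_one, one_mul, pow_one]
        exact (pow_le_pow_right₀ hp1 (Nat.le_succ _)).trans hB1
      · rw [norm_zero, zero_mul]
        positivity
    -- The functional relation expresses `Ψ_p` through `T` and the terms with `j ≥ 1`.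
    refine ⟨B, fun n => ?_⟩
    have h := coeff_sum_psiTermOver p K (Nat.le_succ n)
    rw [Finset.sum_range_succ', psiTermOver_zero, map_add, map_sum] at h
    rw [eq_sub_of_add_eq' h, sub_eq_add_neg, ← Finset.sum_neg_distrib]
    have hr : 0 < ((p : ℝ) ^ (m + 1)) ^ n := by positivity
    rw [← le_div_iff₀ hr]
    refine (IsUltrametricDist.norm_add_le_max _ _).trans (max_le ?_ ?_)
    · rw [le_div_iff₀ hr]
      exact hX n
    · refine IsUltrametricDist.norm_sum_le_of_forall_le_of_nonneg (by positivity) fun j _ => ?_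
      rw [norm_neg, le_div_iff₀ hr]
      exact hterm (j + 1) (Nat.succ_ne_zero j) n

theorem isEntireSeries_psiOver : IsEntireSeries (psiOver p K) := by
  intro r hr
  obtain ⟨m, hm⟩ := pow_unbounded_of_one_lt r
    (by exact_mod_cast hp.out.one_lt : (1 : ℝ) < p)
  obtain ⟨M, hM⟩ := exists_gaussLE_psiOver p K m
  exact ⟨M, hM.mono hr hm.le le_rfl⟩

theorem isEntireSeries_psiTermOver (j : ℕ) : IsEntireSeries (psiTermOver p K j) :=
  (((isEntireSeries_psiOver p K).rescale _).pow _).const_mul _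

/-- The partial sums of the functional relation converge to `T` uniformly on discs, because in each
degree the error is a finite sum of far terms. -/
theorem gaussLE_sum_psiTermOver_sub_X {m N : ℕ} (h : m + 1 < N) :
    GaussLE ((p : ℝ) ^ m) (((p : ℝ) ^ N)⁻¹) (∑ j ∈ Finset.range N, psiTermOver p K j - X) := by
  have hp1 : (1 : ℝ) ≤ p := by exact_mod_cast hp.out.one_le
  have hp0 : (0 : ℝ) < p := by linarith
  intro n
  have hr : 0 < ((p : ℝ) ^ m) ^ n := by positivity
  rw [map_sub, ← coeff_sum_psiTermOver p K (le_max_left n N), ← neg_sub, norm_neg, map_sum, map_sum,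
    ← Finset.sum_Ico_eq_sub _ (le_max_right n N), ← le_div_iff₀ hr]
  refine IsUltrametricDist.norm_sum_le_of_forall_le_of_nonneg (by positivity) fun j hj => ?_
  rw [Finset.mem_Ico] at hj
  rw [le_div_iff₀ hr]
  refine (gaussLE_psiTermOver_of_lt p K (h.trans_le hj.1) n).trans ?_
  exact inv_anti₀ (by positivity) (pow_le_pow_right₀ hp1 hj.1)

/-- The values of `Ψ_p` on `ℚ_[p]` lie in `ℚ_[p]`. -/
theorem seriesEval_psiOver_algebraMap (x : ℚ_[p]) :
    seriesEval (psiOver p K) (algebraMap ℚ_[p] K x) =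
      algebraMap ℚ_[p] K (seriesEval (psiOver p ℚ_[p]) x) := by
  have h := ((isEntireSeries_psiOver p ℚ_[p]).summable x).hasSum.map (algebraMap ℚ_[p] K)
    (algebraMapCLM ℚ_[p] K).continuous
  refine Eq.trans ?_ h.tsum_eq
  exact tsum_congr fun n => by simp [coeff_psiOver]

variable [CompleteSpace K]

/-- The functional relation holds for the values of `Ψ_p`. -/
theorem tendsto_sum_seriesEval_psiOver (x : K) :
    Filter.Tendsto (fun N => ∑ j ∈ Finset.range N,
      ((p : K) ^ j)⁻¹ * seriesEval (psiOver p K) ((p : K) ^ j * x) ^ p ^ j)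
      Filter.atTop (nhds x) := by
  have hp1 : (1 : ℝ) < p := by exact_mod_cast hp.out.one_lt
  obtain ⟨m, hm⟩ := pow_unbounded_of_one_lt ‖x‖ hp1
  have hlim : Filter.Tendsto (fun N : ℕ => ((p : ℝ) ^ N)⁻¹) Filter.atTop (nhds 0) :=
    (tendsto_pow_atTop_atTop_of_one_lt hp1).inv_tendsto_atTop
  rw [tendsto_iff_norm_sub_tendsto_zero]
  refine squeeze_zero' (Filter.Eventually.of_forall fun _ => norm_nonneg _) ?_ hlim
  filter_upwards [Filter.eventually_gt_atTop (m + 1)] with N hN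
  have h := norm_seriesEval_le hm.le (gaussLE_sum_psiTermOver_sub_X p K hN)
  rw [seriesEval_sub (IsEntireSeries.sum _ fun j _ => isEntireSeries_psiTermOver p K j)
    IsEntireSeries.X, seriesEval_X, seriesEval_sum_range (isEntireSeries_psiTermOver p K)] at h
  simp_rw [psiTermOver, seriesEval_const_mul,
    seriesEval_pow ((isEntireSeries_psiOver p K).rescale _), seriesEval_rescale] at h
  exact h

/-! ### Integrality and continuity on `ℚ_p` -/

/-- `Ψ_p` maps `ℚ_[p]` to the closed unit disc. The functional relations at `x` and at `p * x`
combine to `Ψ_p(x) = ∑_{j ≥ 1} p^(-j) (X_j ^ (p ^ (j - 1)) - X_j ^ (p ^ j))` with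
`X_j = Ψ_p(p^j x)`. If all `X_j` are `p`-adic integers, then so are the terms of this sum, since
`X_j ≡ X_j ^ p` modulo `p`. -/
theorem norm_seriesEval_psiOver_le_one (x : ℚ_[p]) : ‖seriesEval (psiOver p ℚ_[p]) x‖ ≤ 1 := by
  have hp1 : (1 : ℝ) < p := by exact_mod_cast hp.out.one_lt
  have hp0 : (p : ℚ_[p]) ≠ 0 := by exact_mod_cast hp.out.ne_zero
  obtain ⟨m, hm⟩ := pow_unbounded_of_one_lt ‖x‖ hp1
  replace hm := hm.le
  induction m generalizing x with
  | zero =>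
    exact norm_seriesEval_le (by simpa using hm)
      (gaussLE_psiOver_of_le_one p ℚ_[p] zero_le_one le_rfl)
  | succ m ih =>
    set F := seriesEval (psiOver p ℚ_[p]) with hF
    have hX : ∀ j : ℕ, ‖F ((p : ℚ_[p]) ^ (j + 1) * x)‖ ≤ 1 := by
      intro j
      apply ih
      have h1 : ‖(p : ℚ_[p])‖ ^ j ≤ 1 := pow_le_one₀ (norm_nonneg _) (Padic.norm_p_lt_one.le)
      rw [norm_mul, norm_pow, pow_succ, mul_assoc]
      refine (mul_le_of_le_one_left (by positivity) h1).trans ?_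
      rw [Padic.norm_p, inv_mul_le_iff₀ (by linarith), ← pow_succ']
      exact hm
    have hterm : ∀ j : ℕ, ‖((p : ℚ_[p]) ^ (j + 1))⁻¹ *
        (F ((p : ℚ_[p]) ^ (j + 1) * x) ^ p ^ (j + 1) - F ((p : ℚ_[p]) ^ (j + 1) * x) ^ p ^ j)‖
        ≤ 1 := by
      intro j
      obtain ⟨z, hz⟩ : ∃ z : ℤ_[p], (z : ℚ_[p]) = F ((p : ℚ_[p]) ^ (j + 1) * x) := ⟨⟨_, hX j⟩, rfl⟩
      have hdvd : (p : ℤ_[p]) ∣ z ^ p - z := by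
        rw [← Ideal.mem_span_singleton, ← PadicInt.maximalIdeal_eq_span_p, ← PadicInt.ker_toZMod,
          RingHom.mem_ker, map_sub, map_pow, ZMod.pow_card, sub_self]
      obtain ⟨w, hw⟩ := dvd_sub_pow_of_dvd_sub hdvd j
      rw [← pow_mul, ← pow_succ'] at hw
      have hw' : F ((p : ℚ_[p]) ^ (j + 1) * x) ^ p ^ (j + 1) - F ((p : ℚ_[p]) ^ (j + 1) * x) ^ p ^ j
          = (p : ℚ_[p]) ^ (j + 1) * w := by
        rw [← hz]
        exact_mod_cast congrArg (fun t : ℤ_[p] => (t : ℚ_[p])) hw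
      rw [hw', inv_mul_cancel_left₀ (pow_ne_zero _ hp0)]
      exact w.2
    have h1 := (tendsto_sum_seriesEval_psiOver p ℚ_[p] x).comp (Filter.tendsto_add_atTop_nat 1)
    have h2 := (tendsto_sum_seriesEval_psiOver p ℚ_[p] ((p : ℚ_[p]) * x)).const_mul (p : ℚ_[p])⁻¹
    rw [inv_mul_cancel_left₀ hp0] at h2
    -- The relation at `x` and the relation at `p * x`, divided by `p`, have the same limit. Pairing
    -- the term `j + 1` of the first with the term `j` of the second leaves `F x` unpaired.
    have h3 := (h1.sub h2).norm
    rw [sub_self, norm_zero] at h3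
    obtain ⟨N, hN⟩ := (h3.eventually (gt_mem_nhds zero_lt_one)).exists
    simp only [Function.comp_apply, Finset.sum_range_succ', pow_zero, inv_one, one_mul, pow_one,
      Finset.mul_sum] at hN
    rw [add_sub_right_comm, ← Finset.sum_sub_distrib] at hN
    have h4 : ‖∑ j ∈ Finset.range N, (((p : ℚ_[p]) ^ (j + 1))⁻¹ *
        F ((p : ℚ_[p]) ^ (j + 1) * x) ^ p ^ (j + 1) -
        (p : ℚ_[p])⁻¹ * (((p : ℚ_[p]) ^ j)⁻¹ * F ((p : ℚ_[p]) ^ j * (p * x)) ^ p ^ j))‖ ≤ 1 := by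
      refine IsUltrametricDist.norm_sum_le_of_forall_le_of_nonneg zero_le_one fun j _ => ?_
      have e : (p : ℚ_[p])⁻¹ * (((p : ℚ_[p]) ^ j)⁻¹ * F ((p : ℚ_[p]) ^ j * (p * x)) ^ p ^ j) =
          ((p : ℚ_[p]) ^ (j + 1))⁻¹ * F ((p : ℚ_[p]) ^ (j + 1) * x) ^ p ^ j := by
        rw [← mul_assoc, ← mul_assoc ((p : ℚ_[p]) ^ j), ← mul_inv, ← pow_succ', ← pow_succ]
      rw [e, ← mul_sub]
      exact hterm j
    rw [← norm_neg] at h4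
    have h5 := (IsUltrametricDist.norm_add_le_max _ _).trans (max_le hN.le h4)
    rwa [add_neg_cancel_comm] at h5

/-- On the closed unit disc `Ψ_p` is `1`-Lipschitz, as a power series with integral coefficients. -/
theorem norm_seriesEval_psiOver_sub_le_of_le_one {x y : K} (hx : ‖x‖ ≤ 1) (hy : ‖y‖ ≤ 1) :
    ‖seriesEval (psiOver p K) x - seriesEval (psiOver p K) y‖ ≤ ‖x - y‖ := by
  rw [seriesEval, seriesEval, ← ((isEntireSeries_psiOver p K).summable x).tsum_sub
    ((isEntireSeries_psiOver p K).summable y)]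
  refine IsUltrametricDist.norm_tsum_le_of_forall_le fun n => ?_
  rw [← mul_sub, norm_mul, coeff_psiOver]
  exact (mul_le_of_le_one_left (norm_nonneg _)
    (IsUltrametricDist.norm_intCast_le_one K _)).trans (norm_pow_sub_pow_le_of_le_one hx hy n)

/-- Near points of `ℚ_[p]` the function `Ψ_p` is `1`-Lipschitz. In the difference of the functional
relations at `x + h` and `x`, the `j`-th terms contain `p ^ j`-th powers of elements of norm at most `1` that differ
by at most `‖p ^ j * h‖`, and the factor `p ^ (-j)` turns this into `‖h‖`. -/
theorem norm_seriesEval_psiOver_sub_le (x : ℚ_[p]) {h : K} (hh : ‖h‖ ≤ 1) :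
    ‖seriesEval (psiOver p K) (algebraMap ℚ_[p] K x + h) -
      seriesEval (psiOver p K) (algebraMap ℚ_[p] K x)‖ ≤ ‖h‖ := by
  have hp1 : (1 : ℝ) < p := by exact_mod_cast hp.out.one_lt
  obtain ⟨m, hm⟩ := pow_unbounded_of_one_lt ‖x‖ hp1
  replace hm := hm.le
  induction m generalizing x h with
  | zero =>
    have hx : ‖algebraMap ℚ_[p] K x‖ ≤ 1 := by simpa using hm
    simpa using norm_seriesEval_psiOver_sub_le_of_le_one p K
      ((IsUltrametricDist.norm_add_le_max _ h).trans (max_le hx hh)) hx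
  | succ m ih =>
    rcases eq_or_ne h 0 with rfl | h0
    · simp
    set F := seriesEval (psiOver p K) with hF
    set a := algebraMap ℚ_[p] K x with ha
    have hpn : ∀ j : ℕ, ‖(p : K) ^ j‖ = ((p : ℝ) ^ j)⁻¹ := fun j => by
      rw [norm_pow, norm_natCast_prime_of_normedAlgebra, inv_pow]
    have hpn1 : ∀ j : ℕ, ‖(p : K) ^ j‖ ≤ 1 := fun j => by
      rw [hpn]
      exact inv_le_one_of_one_le₀ (one_le_pow₀ hp1.le)
    have hmap : ∀ j : ℕ, (p : K) ^ j * a = algebraMap ℚ_[p] K ((p : ℚ_[p]) ^ j * x) := by simp [ha]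
    have hFa : ∀ j : ℕ, ‖F ((p : K) ^ j * a)‖ ≤ 1 := fun j => by
      rw [hmap, hF, seriesEval_psiOver_algebraMap, norm_algebraMap']
      exact norm_seriesEval_psiOver_le_one p _
    have hdiff : ∀ j : ℕ, ‖F ((p : K) ^ (j + 1) * (a + h)) - F ((p : K) ^ (j + 1) * a)‖ ≤
        ‖(p : K) ^ (j + 1) * h‖ := by
      intro j
      rw [mul_add, hmap]
      have hle : ‖(p : K) ^ (j + 1) * h‖ ≤ 1 := by
        rw [norm_mul]
        exact mul_le_one₀ (hpn1 _) (norm_nonneg _) hh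
      refine ih _ hle ?_
      have h1 : ‖(p : ℚ_[p])‖ ^ j ≤ 1 := pow_le_one₀ (norm_nonneg _) (Padic.norm_p_lt_one.le)
      rw [norm_mul, norm_pow, pow_succ, mul_assoc]
      refine (mul_le_of_le_one_left (by positivity) h1).trans ?_
      rw [Padic.norm_p, inv_mul_le_iff₀ (by linarith), ← pow_succ']
      exact hm
    have hterm : ∀ j : ℕ, ‖((p : K) ^ (j + 1))⁻¹ * F ((p : K) ^ (j + 1) * (a + h)) ^ p ^ (j + 1) -
        ((p : K) ^ (j + 1))⁻¹ * F ((p : K) ^ (j + 1) * a) ^ p ^ (j + 1)‖ ≤ ‖h‖ := by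
      intro j
      have hle : ‖F ((p : K) ^ (j + 1) * (a + h))‖ ≤ 1 := by
        rw [← sub_add_cancel (F _) (F ((p : K) ^ (j + 1) * a))]
        refine (IsUltrametricDist.norm_add_le_max _ _).trans (max_le ((hdiff j).trans ?_) (hFa _))
        rw [norm_mul]
        exact mul_le_one₀ (hpn1 _) (norm_nonneg _) hh
      have hp' : 0 < ‖(p : K) ^ (j + 1)‖ := by
        rw [hpn]
        positivity
      rw [← mul_sub, norm_mul, norm_inv, inv_mul_le_iff₀ hp', ← norm_mul]
      exact (norm_pow_sub_pow_le_of_le_one hle (hFa _) _).trans (hdiff j)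
    have h1 := (tendsto_sum_seriesEval_psiOver p K (a + h)).sub
      (tendsto_sum_seriesEval_psiOver p K a)
    rw [add_sub_cancel_left] at h1
    -- As `h ≠ 0`, some partial sum is within `‖h‖` of the limit `h`.
    obtain ⟨N, hN⟩ := ((tendsto_iff_norm_sub_tendsto_zero.1
      (h1.comp (Filter.tendsto_add_atTop_nat 1))).eventually
        (gt_mem_nhds (norm_pos_iff.2 h0))).exists
    simp only [Function.comp_apply, Finset.sum_range_succ', pow_zero, inv_one, one_mul,
      pow_one] at hN
    rw [add_sub_add_comm, ← Finset.sum_sub_distrib] at hN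
    have h4 := IsUltrametricDist.norm_sum_le_of_forall_le_of_nonneg (norm_nonneg h)
      (s := Finset.range N) fun j _ => hterm j
    have h5 := (IsUltrametricDist.norm_add_le_max _ h).trans (max_le hN.le le_rfl)
    rw [sub_add_cancel] at h5
    rw [← norm_neg] at h4
    have h6 := (IsUltrametricDist.norm_add_le_max _ _).trans (max_le h5 h4)
    rwa [add_neg_cancel_comm] at h6

end Psi

/-! ### The function on `ℂ_p` -/

theorem PadicComplexInt.mem_iff_norm_le_one (p : ℕ) [Fact p.Prime] (x : ℂ_[p]) :
    x ∈ 𝓞_ℂ_[p] ↔ ‖x‖ ≤ 1 := by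
  rw [PadicComplex.norm_eq_norm]
  exact (Valued.toNormedField.norm_le_one_iff (L := ℂ_[p]) (Γ₀ := NNReal)).symm

theorem mainTheorem7 (p : ℕ) [Fact p.Prime] :
    -- the power series `Ψ_p` converges on all of `ℂ_p`
    (∀ x : ℂ_[p], Summable fun n : ℕ => ((coeff n (psiSeries p) : ℤ) : ℂ_[p]) * x ^ n) ∧
    -- `Ψ_p` restricts to a uniformly continuous map `ℚ_p → ℤ_p`
    (∃ g : ℚ_[p] → ℤ_[p],
      (∀ x : ℚ_[p], Psi p (algebraMap ℚ_[p] ℂ_[p] x) = algebraMap ℚ_[p] ℂ_[p] (g x : ℚ_[p])) ∧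
      UniformContinuous g) ∧
    -- `Ψ_p (x + p ^ j ℂ_p°) ⊆ Ψ_p x + p ^ j ℂ_p°`
    (∀ (j : ℕ) (x : ℚ_[p]), ∀ y ∈ 𝓞_ℂ_[p], ∃ z ∈ 𝓞_ℂ_[p],
      Psi p (algebraMap ℚ_[p] ℂ_[p] x + (p : ℂ_[p]) ^ j * y) =
        Psi p (algebraMap ℚ_[p] ℂ_[p] x) + (p : ℂ_[p]) ^ j * z) := by
  obtain ⟨g, hg⟩ : ∃ g : ℚ_[p] → ℤ_[p], ∀ x, (g x : ℚ_[p]) = seriesEval (psiOver p ℚ_[p]) x :=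
    ⟨fun x => ⟨_, norm_seriesEval_psiOver_le_one p x⟩, fun _ => rfl⟩
  refine ⟨(isEntireSeries_psiOver p ℂ_[p]).summable, ⟨g, fun x => ?_, ?_⟩, ?_⟩
  · rw [hg]
    exact seriesEval_psiOver_algebraMap p ℂ_[p] x
  · -- The `1`-Lipschitz estimate holds only at distances up to `1`, hence `δ = min ε 1`.
    rw [Metric.uniformContinuous_iff]
    intro ε hε
    refine ⟨min ε 1, lt_min hε one_pos, fun {x y} hxy => ?_⟩
    rw [dist_eq_norm, lt_min_iff] at hxy
    have h := norm_seriesEval_psiOver_sub_le p ℚ_[p] y hxy.2.le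
    rw [Algebra.algebraMap_self, RingHom.id_apply, add_sub_cancel] at h
    rw [dist_eq_norm, PadicInt.norm_def, PadicInt.coe_sub, hg, hg]
    exact h.trans_lt hxy.1
  · intro j x y hy
    rw [PadicComplexInt.mem_iff_norm_le_one] at hy
    have hp0 : (p : ℂ_[p]) ^ j ≠ 0 :=
      pow_ne_zero _ (Nat.cast_ne_zero.2 (Fact.out : p.Prime).ne_zero)
    have hpj : ‖(p : ℂ_[p]) ^ j‖ ≤ 1 := by
      rw [norm_pow]
      refine pow_le_one₀ (norm_nonneg _) ?_
      exact IsUltrametricDist.norm_natCast_le_one ℂ_[p] p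
    have hle : ‖(p : ℂ_[p]) ^ j * y‖ ≤ ‖(p : ℂ_[p]) ^ j‖ := by
      rw [norm_mul]
      exact mul_le_of_le_one_right (norm_nonneg _) hy
    refine ⟨((p : ℂ_[p]) ^ j)⁻¹ * (Psi p (algebraMap ℚ_[p] ℂ_[p] x + (p : ℂ_[p]) ^ j * y) -
      Psi p (algebraMap ℚ_[p] ℂ_[p] x)), ?_, ?_⟩
    · rw [PadicComplexInt.mem_iff_norm_le_one, norm_mul, norm_inv,
        inv_mul_le_iff₀ (norm_pos_iff.2 hp0), mul_one]
      exact (norm_seriesEval_psiOver_sub_le p ℂ_[p] x (hle.trans hpj)).trans hle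
    · rw [mul_inv_cancel_left₀ hp0, add_sub_cancel]
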